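/- \textbf{Theorem.} Let $\varepsilon>0$ be a real number and let $n\ge 1$. Then the $\varepsilon$-approximate total closed projection operator on $\mathbb{R}^n$ (with the Euclidean metric $d$), $$\varepsilon\text{-}\mathrm{Proj}_{\mathbb{R}^n}:\subseteq \mathbb{R}^n\times\mathcal{A}(\mathbb{R}^n)\rightrightarrows\mathbb{R}^n,\qquad (x,A)\mapsto\{y\in A : d(x,y)\le(1+\varepsilon)\,d(x,A)\},$$ whose domain consists of all pairs $(x,A)$ with $x\in\mathbb{R}^n$ and $A\subseteq\mathbb{R}^n$ closed and nonempty, is computable. That is, there is a computable partial function $F:\subseteq\mathbb{N}^{\mathbb{N}}\to\mathbb{N}^{\mathbb{N}}$ (a single algorithm which reads an infinite input sequence and produces, one after the other, the entries of an infinite output sequence) such that, for every such pair $(x,A)$, every Cauchy name $p$ of $x$ and every total-information name $p'$ of $A$, $F(\langle p,p'\rangle)$ is defined and is a Cauchy name of some $y\in A$ with $d(x,y)\le(1+\varepsilon)\,d(x,A)$. Here $\alpha:\mathbb{N}\to\mathbb{Q}^n$ is any effective enumeration of $\mathbb{Q}^n$, $(r_m)_m$ is any effective enumeration of the nonnegative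 rationals, and $B_{\langle k,m\rangle}$ is the open ball with centre $\alpha(k)$ and radius $r_m$, with $\langle\cdot,\cdot\rangle$ a standard computable pairing on $\mathbb{N}$; for sequences, $\langle p,p'\rangle=(p(0),p'(0),p(1),p'(1),\dots)$. A \emph{Cauchy name} of $x\in\mathbb{R}^n$ is a sequence $p\in\mathbb{N}^{\mathbb{N}}$ with $d(\alpha(p(i)),\alpha(p(j)))\le 2^{-i}$ for all $i\le j$ and $\lim_i\alpha(p(i))=x$. A \emph{total-information name} of a closed set $A$ is a sequence $\langle p_0,p_1\rangle$ such that $A=\mathbb{R}^n\setminus\bigcup_{k\in\mathrm{range}(p_0)}B_k$ and, for all $k\in\mathbb{N}$, $k\in\mathrm{range}(p_1)$ if and only if $B_k\cap A\neq\emptyset$. -/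

import Mathlib

open Filter Topology TopologicalSpace

noncomputable section

/-! ### Type-2 computability: programs reading an infinite input sequence -/

/-- Programs that compute with natural numbers and may at any time read a digit of an infinite
input sequence `p : ℕ → ℕ`. This is the syntax of the partial recursive functions with one more
basic instruction, `oracle`. -/
inductive OracleCode : Type
  | zero : OracleCode
  | succ : OracleCode
  | left : OracleCode
  | right : OracleCode
  | oracle : OracleCode
  | pair : OracleCode → OracleCode → OracleCode
  | comp : OracleCode → OracleCode → OracleCode
  | prec : OracleCode → OracleCode → OracleCode
  | rfind : OracleCode → OracleCode

/-- The partial function computed by a program on the input sequence `p`. The clauses are those of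
`Nat.RecursiveIn {p}`; here the program is independent of `p`. -/
def OracleCode.eval (p : ℕ → ℕ) : OracleCode → ℕ →. ℕ
  | .zero => fun _ => Part.some 0
  | .succ => fun n => Part.some (n + 1)
  | .left => fun n => Part.some n.unpair.1
  | .right => fun n => Part.some n.unpair.2
  | .oracle => fun n => Part.some (p n)
  | .pair f g => fun n => (f.eval p n).bind fun a => (g.eval p n).map fun b => Nat.pair a b
  | .comp f g => fun n => (g.eval p n).bind fun a => f.eval p a
  | .prec f g => fun n =>
      n.unpair.2.rec (f.eval p n.unpair.1) fun y ih =>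
        ih.bind fun i => g.eval p (Nat.pair n.unpair.1 (Nat.pair y i))
  | .rfind f => fun a =>
      Nat.rfind fun n => (f.eval p (Nat.pair a n)).map fun m => decide (m = 0)

/-- A partial function on Baire space is computable if a single program, given read access to the
input `p`, produces the successive entries of the output: `F p = q` iff the program yields `q k`
for every `k` (and `F p` is undefined iff the program fails to yield some entry). -/
def BaireComputable (F : (ℕ → ℕ) →. (ℕ → ℕ)) : Prop :=
  ∃ c : OracleCode, ∀ p q : ℕ → ℕ, q ∈ F p ↔ ∀ k, q k ∈ c.eval p k

/-! ### Represented spaces and computable multi-valued functions -/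

/-- A naming system for `X`: a partial function from Baire space to `X`, given by its graph
(`IsName p x` says that `p` is a name of `x`). -/
structure BaireRepresentation (X : Type*) where
  IsName : (ℕ → ℕ) → X → Prop
  unique : ∀ p x y, IsName p x → IsName p y → x = y

/-- The even-indexed half `p₀` of `p = ⟨p₀, p₁⟩`. -/
def evenPart (p : ℕ → ℕ) : ℕ → ℕ := fun i => p (2 * i)

/-- The odd-indexed half `p₁` of `p = ⟨p₀, p₁⟩`. -/
def oddPart (p : ℕ → ℕ) : ℕ → ℕ := fun i => p (2 * i + 1)

/-- The product representation: `⟨p₀, p₁⟩` names `(x, y)` iff `p₀` names `x` and `p₁` names `y`. -/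
def BaireRepresentation.prod {X Y : Type*} (δ : BaireRepresentation X) (δ' : BaireRepresentation Y) :
    BaireRepresentation (X × Y) where
  IsName p z := δ.IsName (evenPart p) z.1 ∧ δ'.IsName (oddPart p) z.2
  unique _ _ _ hx hy := Prod.ext (δ.unique _ _ _ hx.1 hy.1) (δ'.unique _ _ _ hx.2 hy.2)

/-- A partial multi-valued function from `X` to `Y`: its domain and its sets of admissible values. -/
structure PartialMultimap (X Y : Type*) where
  dom : Set X
  val : X → Set Y

/-- `F` realizes `f`: it sends every name of every point `x` of the domain of `f` to a name of some
element of `f x`. -/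
def Realizes {X Y : Type*} (δ : BaireRepresentation X) (δ' : BaireRepresentation Y)
    (F : (ℕ → ℕ) →. (ℕ → ℕ)) (f : PartialMultimap X Y) : Prop :=
  ∀ (p : ℕ → ℕ) (x : X), δ.IsName p x → x ∈ f.dom →
    ∃ q ∈ F p, ∃ y ∈ f.val x, δ'.IsName q y

/-- A partial multi-valued function between represented spaces is computable if it has a
computable realizer. -/
def ComputableMultimap {X Y : Type*} (δ : BaireRepresentation X) (δ' : BaireRepresentation Y)
    (f : PartialMultimap X Y) : Prop :=
  ∃ F : (ℕ → ℕ) →. (ℕ → ℕ), BaireComputable F ∧ Realizes δ δ' F f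

/-! ### The representations of points and of closed sets in a metric space -/

section MetricRepresentations

variable {X : Type*} [MetricSpace X]

/-- The Cauchy representation with respect to a sequence `α` in `X`: `p` names `x` iff
`α (p 0), α (p 1), …` is an effective Cauchy sequence with limit `x`. -/
def cauchyRep (α : ℕ → X) : BaireRepresentation X where
  IsName p x := (∀ i j, i ≤ j → dist (α (p i)) (α (p j)) ≤ (2 : ℝ)⁻¹ ^ i) ∧
    Tendsto (fun i => α (p i)) atTop (𝓝 x)
  unique _ _ _ hx hy := tendsto_nhds_unique hx.2 hy.2

/-- The open basic ball with index `k = ⟨n, m⟩`: its centre is `α n` and its radius is `r m`. -/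
def basicBall (α : ℕ → X) (r : ℕ → ℚ) (k : ℕ) : Set X :=
  Metric.ball (α k.unpair.1) (r k.unpair.2 : ℝ)

/-- Negative information: `p` lists basic balls whose union is the complement of `A`. -/
def IsNegativeName (α : ℕ → X) (r : ℕ → ℚ) (p : ℕ → ℕ) (A : Closeds X) : Prop :=
  (A : Set X) = (⋃ k ∈ Set.range p, basicBall α r k)ᶜ

/-- Positive information: `p` lists exactly the basic balls that meet `A`. -/
def IsPositiveName (α : ℕ → X) (r : ℕ → ℚ) (p : ℕ → ℕ) (A : Closeds X) : Prop :=
  ∀ k, k ∈ Set.range p ↔ (basicBall α r k ∩ (A : Set X)).Nonempty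

/-- Total information: `⟨p₀, p₁⟩` names `A` iff `p₀` is a negative name of `A` and `p₁` is a
positive name of `A`. -/
def totalRep (α : ℕ → X) (r : ℕ → ℚ) : BaireRepresentation (Closeds X) where
  IsName p A := IsNegativeName α r (evenPart p) A ∧ IsPositiveName α r (oddPart p) A
  unique _ _ _ hA hB := SetLike.coe_injective (hA.1.trans hB.1.symm)

end MetricRepresentations

/-- The `ε`-approximate closed projection operator on `X`. Its domain consists of the pairs `(x, A)`
with `A` closed and nonempty, and its values are the `ε`-projection points of `x` onto `A`. -/
def approxProjection (X : Type*) [MetricSpace X] (ε : ℝ) :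
    PartialMultimap (X × Closeds X) X where
  dom := {z | (z.2 : Set X).Nonempty}
  val z := {y | y ∈ (z.2 : Set X) ∧ dist z.1 y ≤ (1 + ε) * Metric.infDist z.1 (z.2 : Set X)}

/-! ### Effective numberings of rational data -/

/-- A computable sequence of rational numbers. -/
def IsComputableRatSeq (u : ℕ → ℚ) : Prop :=
  ∃ a b c : ℕ → ℕ, Computable a ∧ Computable b ∧ Computable c ∧
    ∀ k, u k = ((a k : ℚ) - (b k : ℚ)) / ((c k : ℚ) + 1)

/-- An effective enumeration of `ℚⁿ`. -/
def IsEffectiveEnumeration {n : ℕ} (α : ℕ → Fin n → ℚ) : Prop :=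
  (∀ i, IsComputableRatSeq fun k => α k i) ∧ Function.Surjective α

/-- An effective enumeration of the nonnegative rational numbers. -/
def IsEffectiveRadiusEnumeration (r : ℕ → ℚ) : Prop :=
  IsComputableRatSeq r ∧ Set.range r = {s : ℚ | 0 ≤ s}

/-- A sequence in `ℚⁿ`, viewed as a sequence of points of Euclidean space. -/
def rationalPoint {n : ℕ} (α : ℕ → Fin n → ℚ) (k : ℕ) : EuclideanSpace ℝ (Fin n) :=
  WithLp.toLp 2 fun i => (α k i : ℝ)

end

/-! Whether d(x,A) = 0 cannot be decided from a name, but two searches can be run side by side, each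
recognising success after finitely many digits. Positive information yields small balls that meet A,
so points of A close to x are eventually found when d(x,A) = 0. When d(x,A) > 0, a closed ball
around x missing A is compact and hence covered by finitely many negative balls; a grid check
certifies this and gives a lower bound for d(x,A). A ball that meets A and lies within (1 + 1/(E+1))
times that bound of x then contains only admissible points.

The program therefore emits centres of balls meeting A. As long as the flag is 0, the round-k ball
lies within 2^-(k+2) of x. Once the flag is set, every further ball lies inside its predecessor. The
switch keeps the output Cauchy: earlier rounds force d(x,A) < 2^-(k+2), and the balls chosen from
then on lie within 2 d(x,A) of x. If both alternatives are available, either may be taken.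

Each round is one unbounded search over decidable conditions on a finite prefix
(`exists_oracleCode_iterated_search`, `ComputablePred.projectionStep`). `ProjectionStep.sound` says
what a successful test guarantees, `exists_projectionStep` that the search stops, and
`exists_limit_of_steps` that the centres converge to an admissible point at the required rate. -/

/-! ### Programs with an oracle -/

/-- A functional on Baire space with values in `ℕ → ℕ` that is computed by a single program. -/
def UniformlyComputable (f : (ℕ → ℕ) → ℕ → ℕ) : Prop :=
  ∃ c : OracleCode, ∀ p n, c.eval p n = Part.some (f p n)

/-- Every partial recursive function is computed by a program that ignores its oracle. -/
theorem Nat.Partrec.exists_oracleCode {f : ℕ →. ℕ} (hf : Nat.Partrec f) :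
    ∃ c : OracleCode, ∀ p, c.eval p = f := by
  induction hf with
  | zero => exact ⟨.zero, fun p => rfl⟩
  | succ => exact ⟨.succ, fun p => rfl⟩
  | left => exact ⟨.left, fun p => rfl⟩
  | right => exact ⟨.right, fun p => rfl⟩
  | pair _ _ ihf ihg =>
    obtain ⟨cf, hcf⟩ := ihf
    obtain ⟨cg, hcg⟩ := ihg
    refine ⟨.pair cf cg, fun p => funext fun n => ?_⟩
    simp only [OracleCode.eval, hcf, hcg]
    simp [Seq.seq, Part.bind_map]
  | comp _ _ ihf ihg =>
    obtain ⟨cf, hcf⟩ := ihf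
    obtain ⟨cg, hcg⟩ := ihg
    refine ⟨.comp cf cg, fun p => funext fun n => ?_⟩
    simp only [OracleCode.eval, hcf, hcg]
    rfl
  | prec _ _ ihf ihg =>
    obtain ⟨cf, hcf⟩ := ihf
    obtain ⟨cg, hcg⟩ := ihg
    refine ⟨.prec cf cg, fun p => funext fun n => ?_⟩
    simp only [OracleCode.eval, hcf, hcg]
    rfl
  | rfind _ ihf =>
    obtain ⟨cf, hcf⟩ := ihf
    refine ⟨.rfind cf, fun p => funext fun n => ?_⟩
    simp only [OracleCode.eval, hcf]
    rfl

namespace UniformlyComputable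

theorem of_computable {f : ℕ → ℕ} (hf : Computable f) :
    UniformlyComputable fun _ n => f n := by
  obtain ⟨c, hc⟩ := (Partrec.nat_iff.1 hf).exists_oracleCode
  exact ⟨c, fun p n => by rw [hc]; rfl⟩

theorem pair {f g : (ℕ → ℕ) → ℕ → ℕ} (hf : UniformlyComputable f)
    (hg : UniformlyComputable g) : UniformlyComputable fun p n => Nat.pair (f p n) (g p n) := by
  obtain ⟨cf, hcf⟩ := hf
  obtain ⟨cg, hcg⟩ := hg
  exact ⟨.pair cf cg, fun p n => by simp [OracleCode.eval, hcf, hcg]⟩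

theorem comp {f g : (ℕ → ℕ) → ℕ → ℕ} (hf : UniformlyComputable f)
    (hg : UniformlyComputable g) : UniformlyComputable fun p n => f p (g p n) := by
  obtain ⟨cf, hcf⟩ := hf
  obtain ⟨cg, hcg⟩ := hg
  exact ⟨.comp cf cg, fun p n => by simp [OracleCode.eval, hcf, hcg]⟩

theorem oracle : UniformlyComputable fun p n => p n :=
  ⟨.oracle, fun _ _ => rfl⟩

theorem prec {f g : (ℕ → ℕ) → ℕ → ℕ} (hf : UniformlyComputable f)
    (hg : UniformlyComputable g) : UniformlyComputable fun p n =>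
      n.unpair.2.rec (f p n.unpair.1) fun y i => g p (Nat.pair n.unpair.1 (Nat.pair y i)) := by
  obtain ⟨cf, hcf⟩ := hf
  obtain ⟨cg, hcg⟩ := hg
  refine ⟨.prec cf cg, fun p n => ?_⟩
  simp only [OracleCode.eval]
  induction n.unpair.2 with
  | zero => simp [hcf]
  | succ m ih => exact (congrArg (Part.bind · _) ih).trans (by rw [Part.bind_some, hcg])

/-- The initial segments of the oracle can be computed. -/
theorem encode_prefix :
    UniformlyComputable fun p n => Encodable.encode ((List.range n).map p) := by
  -- One recursion step: decode the list built so far, append the next digit, encode again.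
  have hstep : Computable fun n : ℕ => Encodable.encode
      (((Encodable.decode n.unpair.1 : Option (List ℕ)).getD []) ++ [n.unpair.2]) := by
    refine Computable.encode.comp (Computable.list_concat.comp (Computable.option_getD
      (Computable.decode.comp ?_) (Computable.const [])) ?_)
    · exact Computable.fst.comp Computable.unpair
    · exact Computable.snd.comp Computable.unpair
  have hf := of_computable (Computable.const (α := ℕ) (Encodable.encode ([] : List ℕ)))
  have hy : UniformlyComputable fun _ n => n.unpair.2.unpair.1 := of_computable
    (Computable.fst.comp (Computable.unpair.comp (Computable.snd.comp Computable.unpair)))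
  have hi : UniformlyComputable fun _ n => n.unpair.2.unpair.2 := of_computable
    (Computable.snd.comp (Computable.unpair.comp (Computable.snd.comp Computable.unpair)))
  have hg := (of_computable hstep).comp (hi.pair (oracle.comp hy))
  obtain ⟨c, hc⟩ := (hf.prec hg).comp (of_computable (Computable.const 0) |>.pair
    (of_computable Computable.id))
  refine ⟨c, fun p n => (hc p n).trans (congrArg _ ?_)⟩
  simp only [Nat.unpair_pair, id]
  induction n with
  | zero => rfl
  | succ m ih => simp only [ih]; simp [List.range_succ]

end UniformlyComputable

/-- A program that iterates an unbounded search: starting from the state `0`, it repeatedly looks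
for a state that passes a computable test involving the number of the round, the old state, the new
state, and an initial segment of the oracle. -/
theorem exists_oracleCode_iterated_search {P : ℕ × ℕ × ℕ × List ℕ → Prop}
    (hP : ComputablePred P) {len out : ℕ → ℕ} (hlen : Computable len) (hout : Computable out) :
    ∃ c : OracleCode, ∀ (p : ℕ → ℕ) (I : ℕ → Prop), I 0 →
      (∀ k t, I t → ∃ s, P (k, t, s, (List.range (len s)).map p)) →
      (∀ k t s, P (k, t, s, (List.range (len s)).map p) → I s) →
      ∃ t : ℕ → ℕ, t 0 = 0 ∧
        (∀ k, P (k, t k, t (k + 1), (List.range (len (t (k + 1)))).map p)) ∧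
        ∀ k, out (t (k + 1)) ∈ c.eval p k := by
  classical
  obtain ⟨test, htest⟩ : UniformlyComputable fun p n =>
      if P (n.unpair.1.unpair.2.unpair.1, n.unpair.1.unpair.2.unpair.2, n.unpair.2,
        (List.range (len n.unpair.2)).map p) then 0 else 1 := by
    have h1 : Computable fun n : ℕ => cond (decide (P (n.unpair.1.unpair.1.unpair.2.unpair.1,
        n.unpair.1.unpair.1.unpair.2.unpair.2, n.unpair.1.unpair.2,
        (Encodable.decode n.unpair.2 : Option (List ℕ)).getD []))) 0 1 := by
      have hl : Computable fun n : ℕ => n.unpair.1 := Computable.fst.comp Computable.unpair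
      have hr : Computable fun n : ℕ => n.unpair.2 := Computable.snd.comp Computable.unpair
      refine Computable.cond (hP.decide.comp (Computable.pair ?_ (Computable.pair ?_
        (Computable.pair ?_ ?_)))) (Computable.const 0) (Computable.const 1)
      · exact hl.comp (hr.comp (hl.comp hl))
      · exact hr.comp (hr.comp (hl.comp hl))
      · exact hr.comp hl
      · exact Computable.option_getD (Computable.decode.comp hr) (Computable.const [])
    obtain ⟨c, hc⟩ := (UniformlyComputable.of_computable h1).comp
      ((UniformlyComputable.of_computable Computable.id).pair
        (UniformlyComputable.encode_prefix.comp
          (UniformlyComputable.of_computable (hlen.comp (Computable.snd.comp Computable.unpair)))))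
    refine ⟨c, fun p n => (hc p n).trans (congrArg _ ?_)⟩
    simp [Bool.cond_decide]
  obtain ⟨outCode, hout⟩ := UniformlyComputable.of_computable hout
  -- The recursion reaches `t k` at counter `k`, while entry `k` of the output is read from `t (k +
  -- 1)`; hence the successor.
  obtain ⟨arg, harg⟩ := UniformlyComputable.of_computable
    ((Primrec₂.natPair.comp (Primrec.const 0) Primrec.succ).to_comp)
  refine ⟨.comp outCode (.comp (.prec .zero (.rfind test)) arg), fun p I h0 hex hI => ?_⟩
  -- Unbounded search returns the least state passing the test, so minimality is recorded along with
  -- success.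
  choose! next hnext using fun (k t : ℕ) (h : I t) =>
    (⟨Nat.find (hex k t h), Nat.find_spec (hex k t h), fun m hm => Nat.find_min (hex k t h) hm⟩ :
      ∃ s, P (k, t, s, (List.range (len s)).map p) ∧
        ∀ m < s, ¬ P (k, t, m, (List.range (len m)).map p))
  let t : ℕ → ℕ := fun k => Nat.rec 0 next k
  have ht : ∀ k, t (k + 1) = next k (t k) := fun k => rfl
  have hIt : ∀ k, I (t k) := by
    intro k
    induction k with
    | zero => exact h0
    | succ k ih => exact hI k _ _ (hnext k _ ih).1
  have hprec : ∀ k, (OracleCode.prec .zero (.rfind test)).eval p (Nat.pair 0 k) =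
      Part.some (t k) := by
    intro k
    induction k with
    | zero => simp [OracleCode.eval, t]
    | succ k ih =>
      simp only [OracleCode.eval, Nat.unpair_pair] at ih ⊢
      rw [ih, Part.bind_some, ht]
      refine Part.eq_some_iff.2 (Nat.mem_rfind.2 ⟨?_, fun {m} hm => ?_⟩)
      · simp [htest, (hnext k _ (hIt k)).1]
      · simp [htest, (hnext k _ (hIt k)).2 m hm]
  refine ⟨t, rfl, fun k => ?_, fun k => ?_⟩
  · rw [ht]; exact (hnext k _ (hIt k)).1
  · have h2 : (OracleCode.comp (.prec .zero (.rfind test)) arg).eval p k =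
        Part.some (t (k + 1)) := by
      simp only [OracleCode.eval.eq_7, harg, Part.bind_some, hprec]
    rw [OracleCode.eval.eq_7]
    simp only [h2, Part.bind_some, hout, Part.mem_some_iff]

/-! ### Decidability of conditions on rational data -/

section ComputableConditions

variable {β : Type*} [Primcodable β]

namespace ComputablePred

theorem and {p q : β → Prop} (hp : ComputablePred p) (hq : ComputablePred q) :
    ComputablePred fun b => p b ∧ q b := by
  classical
  exact computable_iff.2 ⟨_, Primrec.and.to_comp.comp hp.decide hq.decide, by simp⟩

theorem or {p q : β → Prop} (hp : ComputablePred p) (hq : ComputablePred q) :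
    ComputablePred fun b => p b ∨ q b := by
  classical
  exact computable_iff.2 ⟨_, Primrec.or.to_comp.comp hp.decide hq.decide, by simp⟩

theorem imp {p q : β → Prop} (hp : ComputablePred p) (hq : ComputablePred q) :
    ComputablePred fun b => p b → q b :=
  (hp.not.or hq).of_eq fun _ => imp_iff_not_or.symm

theorem forall_lt {p : β × ℕ → Prop} (hp : ComputablePred p) {f : β → ℕ} (hf : Computable f) :
    ComputablePred fun b => ∀ m < f b, p (b, m) := by
  classical
  refine computable_iff.2 ⟨fun b => Nat.rec true (fun m ih => ih && decide (p (b, m))) (f b),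
    Computable.nat_rec (h := fun b x => x.2 && decide (p (b, x.1))) hf (Computable.const true) ?_,
    funext fun b => ?_⟩
  · exact Primrec.and.to_comp.comp (Computable.snd.comp Computable.snd)
      (hp.decide.comp (Computable.pair Computable.fst (Computable.fst.comp Computable.snd)))
  · beta_reduce
    induction f b with
    | zero => simp
    | succ m ih =>
      simp only at ih ⊢
      rw [Bool.and_eq_true, ← ih, Nat.forall_lt_succ_right, decide_eq_true_iff]

theorem exists_lt {p : β × ℕ → Prop} (hp : ComputablePred p) {f : β → ℕ} (hf : Computable f) :
    ComputablePred fun b => ∃ m < f b, p (b, m) :=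
  (forall_lt hp.not hf).not.of_eq fun b => by push Not; rfl

theorem nat_lt {f g : β → ℕ} (hf : Computable f) (hg : Computable g) :
    ComputablePred fun b => f b < g b :=
  computable_iff.2 ⟨_, Primrec.nat_lt.decide.to_comp.comp hf hg, by simp⟩

theorem nat_eq {f g : β → ℕ} (hf : Computable f) (hg : Computable g) :
    ComputablePred fun b => f b = g b :=
  computable_iff.2 ⟨_, (Primrec.eq (α := ℕ)).decide.to_comp.comp hf hg, by simp⟩

end ComputablePred

theorem Computable.nat_add {f g : β → ℕ} (hf : Computable f) (hg : Computable g) :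
    Computable fun b => f b + g b := Primrec.nat_add.to_comp.comp hf hg

theorem Computable.nat_mul {f g : β → ℕ} (hf : Computable f) (hg : Computable g) :
    Computable fun b => f b * g b := Primrec.nat_mul.to_comp.comp hf hg

theorem Computable.nat_pow_const {f : β → ℕ} (hf : Computable f) (m : ℕ) :
    Computable fun b => f b ^ m := by
  induction m with
  | zero => simpa using Computable.const 1
  | succ m ih => simpa only [pow_succ] using ih.nat_mul hf

theorem Computable.const_nat_pow (m : ℕ) {f : β → ℕ} (hf : Computable f) :
    Computable fun b => m ^ f b := by
  have h : Computable fun b => (Nat.rec 1 (fun _ i => i * m) (f b) : ℕ) :=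
    Computable.nat_rec (h := fun _ x => x.2 * m) hf (Computable.const 1)
      (Computable.nat_mul (Computable.snd.comp Computable.snd) (Computable.const m))
  refine h.of_eq fun b => ?_
  induction f b with
  | zero => rfl
  | succ k ih => simp only [ih, pow_succ]

/-- A computable family of rational numbers. -/
def ComputableRat (u : β → ℚ) : Prop :=
  ∃ a b c : β → ℕ, Computable a ∧ Computable b ∧ Computable c ∧
    ∀ k, u k = ((a k : ℚ) - (b k : ℚ)) / ((c k : ℚ) + 1)

namespace ComputableRat

theorem of_seq {u : ℕ → ℚ} (hu : IsComputableRatSeq u) {f : β → ℕ} (hf : Computable f) :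
    ComputableRat fun b => u (f b) := by
  obtain ⟨a, b, c, ha, hb, hc, h⟩ := hu
  exact ⟨_, _, _, ha.comp hf, hb.comp hf, hc.comp hf, fun k => h (f k)⟩

theorem natCast {f : β → ℕ} (hf : Computable f) : ComputableRat fun b => (f b : ℚ) :=
  ⟨f, fun _ => 0, fun _ => 0, hf, Computable.const 0, Computable.const 0, fun k => by simp⟩

theorem one_div_natCast {f : β → ℕ} (hf : Computable f) (h0 : ∀ b, 0 < f b) :
    ComputableRat fun b => 1 / (f b : ℚ) := by
  refine ⟨fun _ => 1, fun _ => 0, fun b => f b - 1, Computable.const 1, Computable.const 0,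
    Primrec.nat_sub.to_comp.comp hf (Computable.const 1), fun k => ?_⟩
  rw [Nat.cast_sub (h0 k)]
  simp

theorem one_div_natCast_add_one {f : β → ℕ} (hf : Computable f) :
    ComputableRat fun b => 1 / ((f b : ℚ) + 1) := by
  simpa using one_div_natCast (hf.nat_add (Computable.const 1)) fun _ => Nat.succ_pos _

theorem add {u v : β → ℚ} (hu : ComputableRat u) (hv : ComputableRat v) :
    ComputableRat fun b => u b + v b := by
  obtain ⟨a, b, c, ha, hb, hc, h⟩ := hu
  obtain ⟨a', b', c', ha', hb', hc', h'⟩ := hv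
  have h1 : Computable fun k => c k + 1 := hc.nat_add (Computable.const 1)
  have h1' : Computable fun k => c' k + 1 := hc'.nat_add (Computable.const 1)
  -- Denominators are stored minus one: (c+1)(c'+1) = (c(c'+1) + c') + 1.
  refine ⟨_, _, _, (ha.nat_mul h1').nat_add (ha'.nat_mul h1),
    (hb.nat_mul h1').nat_add (hb'.nat_mul h1), (hc.nat_mul h1').nat_add hc', fun k => ?_⟩
  have h2 : ((c k : ℚ) + 1) ≠ 0 := by positivity
  have h2' : ((c' k : ℚ) + 1) ≠ 0 := by positivity
  have h3 : ((c k : ℚ) * (c' k + 1) + c' k + 1) ≠ 0 := by positivity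
  simp only [h, h']
  push_cast
  field_simp
  ring

theorem mul {u v : β → ℚ} (hu : ComputableRat u) (hv : ComputableRat v) :
    ComputableRat fun b => u b * v b := by
  obtain ⟨a, b, c, ha, hb, hc, h⟩ := hu
  obtain ⟨a', b', c', ha', hb', hc', h'⟩ := hv
  refine ⟨_, _, _, (ha.nat_mul ha').nat_add (hb.nat_mul hb'),
    (ha.nat_mul hb').nat_add (hb.nat_mul ha'),
    (hc.nat_mul (hc'.nat_add (Computable.const 1))).nat_add hc', fun k => ?_⟩
  have h2 : ((c k : ℚ) + 1) ≠ 0 := by positivity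
  have h2' : ((c' k : ℚ) + 1) ≠ 0 := by positivity
  have h3 : ((c k : ℚ) * (c' k + 1) + c' k + 1) ≠ 0 := by positivity
  simp only [h, h']
  push_cast
  field_simp
  ring

theorem neg {u : β → ℚ} (hu : ComputableRat u) : ComputableRat fun b => -u b := by
  obtain ⟨a, b, c, ha, hb, hc, h⟩ := hu
  exact ⟨b, a, c, hb, ha, hc, fun k => by simp only [h]; ring⟩

theorem sub {u v : β → ℚ} (hu : ComputableRat u) (hv : ComputableRat v) :
    ComputableRat fun b => u b - v b := by
  simpa only [sub_eq_add_neg] using hu.add hv.neg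

theorem sum {n : ℕ} {u : Fin n → β → ℚ} (hu : ∀ i, ComputableRat (u i)) :
    ComputableRat fun b => ∑ i, u i b := by
  induction n with
  | zero => simpa using natCast (β := β) (Computable.const 0)
  | succ n ih => simpa only [Fin.sum_univ_succ] using (hu 0).add (ih fun i => hu i.succ)

theorem lt {u v : β → ℚ} (hu : ComputableRat u) (hv : ComputableRat v) :
    ComputablePred fun b => u b < v b := by
  obtain ⟨a, b, c, ha, hb, hc, h⟩ := hu
  obtain ⟨a', b', c', ha', hb', hc', h'⟩ := hv
  have h1 : Computable fun k => c k + 1 := hc.nat_add (Computable.const 1)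
  have h1' : Computable fun k => c' k + 1 := hc'.nat_add (Computable.const 1)
  refine (ComputablePred.nat_lt ((ha.nat_mul h1').nat_add (hb'.nat_mul h1))
    ((ha'.nat_mul h1).nat_add (hb.nat_mul h1'))).of_eq fun k => ?_
  have h2 : (0 : ℚ) < (c k : ℚ) + 1 := by positivity
  have h2' : (0 : ℚ) < (c' k : ℚ) + 1 := by positivity
  rw [h, h', div_lt_div_iff₀ h2 h2', ← Nat.cast_lt (α := ℚ)]
  push_cast
  constructor <;> intro h <;> linarith

end ComputableRat

/-- The rational points `u` and `v` have Euclidean distance less than `T`, expressed without square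
roots. -/
def RatDistLT {n : ℕ} (u v : Fin n → ℚ) (T : ℚ) : Prop :=
  0 < T ∧ ∑ i, (u i - v i) * (u i - v i) < T * T

/-- The condition `0 < T` makes squaring reversible, so a Euclidean distance test becomes a
comparison of rationals. -/
theorem ratDistLT_iff {n : ℕ} {u v : Fin n → ℚ} {T : ℚ} : RatDistLT u v T ↔
    dist (WithLp.toLp 2 fun i => (u i : ℝ) : EuclideanSpace ℝ (Fin n))
      (WithLp.toLp 2 fun i => (v i : ℝ)) < T := by
  rw [EuclideanSpace.dist_eq]
  have key : (∑ i, dist ((u i : ℝ)) (v i) ^ 2) = ((∑ i, (u i - v i) * (u i - v i) : ℚ) : ℝ) := by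
    push_cast
    exact Finset.sum_congr rfl fun i _ => by rw [Real.dist_eq, sq_abs, sq]
  constructor
  · rintro ⟨h0, h⟩
    rw [Real.sqrt_lt' (by exact_mod_cast h0)]
    calc _ = ((∑ i, (u i - v i) * (u i - v i) : ℚ) : ℝ) := key
      _ < ((T * T : ℚ) : ℝ) := by exact_mod_cast h
      _ = _ := by push_cast; ring
  · intro h
    have h0 : (0 : ℝ) < T := (Real.sqrt_nonneg _).trans_lt h
    rw [Real.sqrt_lt' h0] at h
    refine ⟨by exact_mod_cast h0, ?_⟩
    have h2 : ((∑ i, (u i - v i) * (u i - v i) : ℚ) : ℝ) < ((T * T : ℚ) : ℝ) := by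
      rw [← key]; push_cast; rw [← sq]; exact h
    exact_mod_cast h2

theorem ComputableRat.ratDistLT {n : ℕ} {u v : β → Fin n → ℚ} {T : β → ℚ}
    (hu : ∀ i, ComputableRat fun b => u b i) (hv : ∀ i, ComputableRat fun b => v b i)
    (hT : ComputableRat T) : ComputablePred fun b => RatDistLT (u b) (v b) (T b) := by
  have h0 : ComputableRat fun _ : β => (0 : ℚ) := by
    simpa using natCast (β := β) (Computable.const 0)
  exact (h0.lt hT).and ((sum fun i => ((hu i).sub (hv i)).mul ((hu i).sub (hv i))).lt (hT.mul hT))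

end ComputableConditions

/-! ### The search condition -/

/-- The entries of a tuple that is coded by iterated pairing. -/
def Nat.unpairField : ℕ → ℕ → ℕ
  | 0, s => s.unpair.1
  | i + 1, s => Nat.unpairField i s.unpair.2

@[simp] theorem Nat.unpairField_zero_pair (a b : ℕ) : Nat.unpairField 0 (Nat.pair a b) = a := by
  simp [Nat.unpairField]

@[simp] theorem Nat.unpairField_succ_pair (i a b : ℕ) :
    Nat.unpairField (i + 1) (Nat.pair a b) = Nat.unpairField i b := by
  simp [Nat.unpairField]

theorem Computable.nat_unpairField (i : ℕ) : Computable (Nat.unpairField i) := by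
  induction i with
  | zero => exact Computable.fst.comp Computable.unpair
  | succ i ih => exact ih.comp (Computable.snd.comp Computable.unpair)

section Search

variable {n : ℕ} (α : ℕ → Fin n → ℚ) (r : ℕ → ℚ)

/-- The points of the grid of mesh `1 / (N + 1)` in the cube with centre `u` and half side
`N + 1`. -/
def ratGridPoint (u : Fin n → ℚ) (N m : ℕ) (j : Fin n) : ℚ :=
  u j + ((m / (2 * (N + 1) ^ 2 + 1) ^ (j : ℕ) % (2 * (N + 1) ^ 2 + 1) : ℕ) * (1 / ((N : ℚ) + 1))
    - ((N : ℚ) + 1))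

/-- A finite certificate that the closed ball with centre `u` and radius `R` is covered by the basic
balls listed at the positions `≡ 1 mod 4` of `σ`. -/
def CoverCertificate (u : Fin n → ℚ) (R : ℚ) (N : ℕ) (σ : List ℕ) : Prop :=
  R < (N : ℚ) + 1 ∧ ∀ m < ((2 * (N + 1) ^ 2 + 1) ^ n),
    RatDistLT (ratGridPoint u N m) u (R + (n : ℕ) * (1 / ((N : ℚ) + 1))) →
      ∃ h < N, 4 * h + 1 < σ.length ∧
        RatDistLT (ratGridPoint u N m) (α (σ.getD (4 * h + 1) 0).unpair.1)
          (r (σ.getD (4 * h + 1) 0).unpair.2 - (n : ℕ) * (1 / ((N : ℚ) + 1)))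

/-- The condition under which a search state `s` may follow the state `t` in round `k`, where `σ` is
an initial segment of the input. A state codes a tuple: a flag telling whether a positive lower
bound for the distance has been found; the index of a basic ball; the position at which it is listed
as meeting the closed set; the index of an approximation of the given point; the index of a radius;
and the fineness of a covering certificate. -/
def ProjectionStep (E : ℕ) (z : ℕ × ℕ × ℕ × List ℕ) : Prop :=
  let k := z.1
  let t := z.2.1
  let s := z.2.2.1
  let σ := z.2.2.2
  let b := Nat.unpairField 1 s
  let j := Nat.unpairField 2 s
  let i := Nat.unpairField 3 s
  let R := r (Nat.unpairField 4 s)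
  let u := α (σ.getD (2 * i) 0)
  let ρ := r b.unpair.2
  4 * j + 3 < σ.length ∧ σ.getD (4 * j + 3) 0 = b ∧ 2 * i < σ.length ∧
    ρ < 1 / ((2 ^ (k + 2) : ℕ) : ℚ) ∧
    ((Nat.unpairField 0 t = 0 ∧ Nat.unpairField 0 s = 0 ∧
        RatDistLT u (α b.unpair.1) (1 / ((2 ^ (k + 2) : ℕ) : ℚ) - 1 / ((i : ℚ) + 1) - ρ)) ∨
      (Nat.unpairField 0 t = 0 ∧ ¬ Nat.unpairField 0 s = 0 ∧
        RatDistLT u (α b.unpair.1)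
          (R - 1 / ((i : ℚ) + 1) + (R - 1 / ((i : ℚ) + 1)) * (1 / ((E : ℚ) + 1))
            - 1 / ((i : ℚ) + 1) - ρ) ∧
        CoverCertificate α r u R (Nat.unpairField 5 s) σ) ∨
      (¬ Nat.unpairField 0 t = 0 ∧ ¬ Nat.unpairField 0 s = 0 ∧
        RatDistLT (α (Nat.unpairField 1 t).unpair.1) (α b.unpair.1)
          (r (Nat.unpairField 1 t).unpair.2 - ρ)))

variable {α r} {β : Type*} [Primcodable β]

theorem ComputableRat.ratGridPoint {u : β → Fin n → ℚ} (hu : ∀ j, ComputableRat fun b => u b j)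
    {N m : β → ℕ} (hN : Computable N) (hm : Computable m) (j : Fin n) :
    ComputableRat fun b => ratGridPoint (u b) (N b) (m b) j := by
  have hB : Computable fun b => 2 * (N b + 1) ^ 2 + 1 :=
    ((Computable.const 2).nat_mul ((hN.nat_add (Computable.const 1)).nat_pow_const 2)).nat_add
      (Computable.const 1)
  have hd : Computable fun b => m b / (2 * (N b + 1) ^ 2 + 1) ^ (j : ℕ) %
      (2 * (N b + 1) ^ 2 + 1) :=
    Primrec.nat_mod.to_comp.comp (Primrec.nat_div.to_comp.comp hm (hB.nat_pow_const j)) hB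
  have h1 : ComputableRat fun b => ((N b : ℚ) + 1) := by
    simpa using natCast (hN.nat_add (Computable.const 1))
  exact (hu j).add (((natCast hd).mul (one_div_natCast_add_one hN)).sub h1)

theorem Computable.list_getD_nat {σ : β → List ℕ} {i : β → ℕ} (hσ : Computable σ)
    (hi : Computable i) : Computable fun b => (σ b).getD (i b) 0 :=
  ((Primrec.list_getD 0).to_comp.comp hσ hi : _)

theorem ComputablePred.coverCertificate (hα : ∀ i, IsComputableRatSeq fun k => α k i)
    (hr : IsComputableRatSeq r) {u : β → Fin n → ℚ} (hu : ∀ j, ComputableRat fun b => u b j)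
    {R : β → ℚ} (hR : ComputableRat R) {N : β → ℕ} (hN : Computable N) {σ : β → List ℕ}
    (hσ : Computable σ) :
    ComputablePred fun b => CoverCertificate α r (u b) (R b) (N b) (σ b) := by
  have hN1 : ComputableRat fun b => ((N b : ℚ) + 1) := by
    simpa using ComputableRat.natCast (hN.nat_add (Computable.const 1))
  have hB : Computable fun b => (2 * (N b + 1) ^ 2 + 1) ^ n :=
    Computable.nat_pow_const (((Computable.const 2).nat_mul
      ((hN.nat_add (Computable.const 1)).nat_pow_const 2)).nat_add (Computable.const 1)) n
  have hmargin : ComputableRat fun b => ((n : ℕ) * (1 / ((N b : ℚ) + 1)) : ℚ) :=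
    (ComputableRat.natCast (Computable.const n)).mul (ComputableRat.one_div_natCast_add_one hN)
  have comp_fst : ∀ {γ δ : Type _} [Primcodable γ] [Primcodable δ] {v : γ → ℚ},
      ComputableRat v → ComputableRat fun x : γ × δ => v x.1 := by
    rintro γ δ _ _ v ⟨a, b, c, ha, hb, hc, h⟩
    exact ⟨_, _, _, ha.comp Computable.fst, hb.comp Computable.fst, hc.comp Computable.fst,
      fun k => h k.1⟩
  have hgrid : ∀ j, ComputableRat fun x : β × ℕ => ratGridPoint (u x.1) (N x.1) x.2 j := fun j =>
    ComputableRat.ratGridPoint (fun j => comp_fst (hu j)) (hN.comp Computable.fst) Computable.snd j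
  have hpos : Computable fun x : (β × ℕ) × ℕ => 4 * x.2 + 1 :=
    ((Computable.const 4).nat_mul Computable.snd).nat_add (Computable.const 1)
  have hσ' : Computable fun x : (β × ℕ) × ℕ => σ x.1.1 :=
    hσ.comp (Computable.fst.comp Computable.fst)
  have hball := Computable.unpair.comp (Computable.list_getD_nat hσ' hpos)
  have hinner : ComputablePred fun x : (β × ℕ) × ℕ => 4 * x.2 + 1 < (σ x.1.1).length ∧
      RatDistLT (ratGridPoint (u x.1.1) (N x.1.1) x.1.2)
        (α ((σ x.1.1).getD (4 * x.2 + 1) 0).unpair.1)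
        (r ((σ x.1.1).getD (4 * x.2 + 1) 0).unpair.2 - (n : ℕ) * (1 / ((N x.1.1 : ℚ) + 1))) :=
    (ComputablePred.nat_lt hpos (Computable.list_length.comp hσ')).and
      (ComputableRat.ratDistLT (fun j => comp_fst (hgrid j))
        (fun j => ComputableRat.of_seq (hα j) (Computable.fst.comp hball))
        ((ComputableRat.of_seq hr (Computable.snd.comp hball)).sub (comp_fst (comp_fst hmargin))))
  have hnear : ComputablePred fun x : β × ℕ => RatDistLT (ratGridPoint (u x.1) (N x.1) x.2)
      (u x.1) (R x.1 + (n : ℕ) * (1 / ((N x.1 : ℚ) + 1))) :=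
    ComputableRat.ratDistLT hgrid (fun j => comp_fst (hu j)) ((comp_fst hR).add (comp_fst hmargin))
  exact (hR.lt hN1).and
    (ComputablePred.forall_lt (hnear.imp (hinner.exists_lt (hN.comp Computable.fst))) hB)

theorem ComputablePred.projectionStep (hα : ∀ i, IsComputableRatSeq fun k => α k i)
    (hr : IsComputableRatSeq r) (E : ℕ) : ComputablePred (ProjectionStep α r E) := by
  have hk : Computable fun z : ℕ × ℕ × ℕ × List ℕ => z.1 := Computable.fst
  have ht : ∀ i, Computable fun z : ℕ × ℕ × ℕ × List ℕ => Nat.unpairField i z.2.1 := fun i =>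
    (Computable.nat_unpairField i).comp (Computable.fst.comp Computable.snd)
  have hs : ∀ i, Computable fun z : ℕ × ℕ × ℕ × List ℕ => Nat.unpairField i z.2.2.1 := fun i =>
    (Computable.nat_unpairField i).comp (Computable.fst.comp (Computable.snd.comp Computable.snd))
  have hσ : Computable fun z : ℕ × ℕ × ℕ × List ℕ => z.2.2.2 :=
    Computable.snd.comp (Computable.snd.comp Computable.snd)
  have hlen := Computable.list_length.comp hσ
  have hj : Computable fun z : ℕ × ℕ × ℕ × List ℕ => 4 * Nat.unpairField 2 z.2.2.1 + 3 :=
    ((Computable.const 4).nat_mul (hs 2)).nat_add (Computable.const 3)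
  have hi : Computable fun z : ℕ × ℕ × ℕ × List ℕ => 2 * Nat.unpairField 3 z.2.2.1 :=
    (Computable.const 2).nat_mul (hs 3)
  have hu := fun j => ComputableRat.of_seq (hα j) (Computable.list_getD_nat hσ hi)
  have hρ := ComputableRat.of_seq hr (Computable.snd.comp (Computable.unpair.comp (hs 1)))
  have hc := fun j => ComputableRat.of_seq (hα j)
    (Computable.fst.comp (Computable.unpair.comp (hs 1)))
  have hρ' := ComputableRat.of_seq hr (Computable.snd.comp (Computable.unpair.comp (ht 1)))
  have hc' := fun j => ComputableRat.of_seq (hα j)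
    (Computable.fst.comp (Computable.unpair.comp (ht 1)))
  have hR := ComputableRat.of_seq hr (hs 4)
  have hη := ComputableRat.one_div_natCast (Computable.const_nat_pow 2
    (hk.nat_add (Computable.const 2))) fun z => by positivity
  have he := ComputableRat.one_div_natCast_add_one (hs 3)
  have hE := ComputableRat.one_div_natCast_add_one
    (Computable.const (α := ℕ × ℕ × ℕ × List ℕ) E)
  have ht0 := ComputablePred.nat_eq (ht 0) (Computable.const 0)
  have hs0 := ComputablePred.nat_eq (hs 0) (Computable.const 0)
  refine (ComputablePred.nat_lt hj hlen).and ((ComputablePred.nat_eq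
    (Computable.list_getD_nat hσ hj) (hs 1)).and ((ComputablePred.nat_lt hi hlen).and
    ((hρ.lt hη).and ((ht0.and (hs0.and ?_)).or ((ht0.and (hs0.not.and (.and ?_ ?_))).or
      (ht0.not.and (hs0.not.and ?_)))))))
  · exact ComputableRat.ratDistLT hu hc ((hη.sub he).sub hρ)
  · exact ComputableRat.ratDistLT hu hc ((((hR.sub he).add ((hR.sub he).mul hE)).sub he).sub hρ)
  · exact ComputablePred.coverCertificate hα hr hu hR (hs 5) hσ
  · exact ComputableRat.ratDistLT hc' hc (hρ'.sub hρ)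

end Search

/-! ### Rational approximation in Euclidean space -/

section Geometry

variable {n : ℕ}

/-- A rational vector, viewed as a point of Euclidean space. -/
noncomputable def ratPoint (u : Fin n → ℚ) : EuclideanSpace ℝ (Fin n) :=
  WithLp.toLp 2 fun i => (u i : ℝ)

theorem ratDistLT_iff_dist {u v : Fin n → ℚ} {T : ℚ} :
    RatDistLT u v T ↔ dist (ratPoint u) (ratPoint v) < T :=
  ratDistLT_iff

/-- The factor √n is replaced by the cruder n to keep the grid margins rational. -/
theorem EuclideanSpace.dist_le_card_mul {x y : EuclideanSpace ℝ (Fin n)} {δ : ℝ} (hδ : 0 ≤ δ)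
    (h : ∀ j, |x j - y j| ≤ δ) : dist x y ≤ n * δ := by
  rw [EuclideanSpace.dist_eq]
  refine Real.sqrt_le_iff.2 ⟨by positivity, ?_⟩
  calc ∑ i, dist (x i) (y i) ^ 2 ≤ ∑ _i : Fin n, δ ^ 2 :=
        Finset.sum_le_sum fun i _ => pow_le_pow_left₀ dist_nonneg (h i) 2
    _ = n * δ ^ 2 := by simp
    _ ≤ (n * n : ℝ) * δ ^ 2 := by
        gcongr
        exact_mod_cast Nat.le_mul_self n
    _ = (n * δ) ^ 2 := by ring

theorem EuclideanSpace.abs_sub_le_dist (x y : EuclideanSpace ℝ (Fin n)) (j : Fin n) :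
    |x j - y j| ≤ dist x y := by
  have := PiLp.norm_apply_le (x - y) j
  rwa [dist_eq_norm]

theorem exists_dist_ratPoint_lt {α : ℕ → Fin n → ℚ} (hα : Function.Surjective α)
    (x : EuclideanSpace ℝ (Fin n)) {δ : ℝ} (hδ : 0 < δ) :
    ∃ k, dist x (ratPoint (α k)) < δ := by
  have hδ' : 0 < δ / (n + 1) := by positivity
  choose u hu using fun j => exists_rat_btwn (lt_add_of_pos_right (x j) hδ')
  obtain ⟨k, rfl⟩ := hα u
  refine ⟨k, (EuclideanSpace.dist_le_card_mul hδ'.le fun j => ?_).trans_lt ?_⟩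
  · change |x j - (α k j : ℝ)| ≤ _
    rw [abs_le]
    constructor <;> linarith [(hu j).1, (hu j).2]
  · rw [mul_div_assoc', div_lt_iff₀ (by positivity)]
    nlinarith

theorem exists_mem_basicBall {α : ℕ → Fin n → ℚ} (hα : Function.Surjective α) {r : ℕ → ℚ}
    (hr : Set.range r = {s : ℚ | 0 ≤ s}) (x : EuclideanSpace ℝ (Fin n)) {δ : ℝ} (hδ : 0 < δ) :
    ∃ b, x ∈ basicBall (rationalPoint α) r b ∧ (r b.unpair.2 : ℝ) < δ := by
  obtain ⟨s, hs0, hsδ⟩ := exists_rat_btwn hδ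
  obtain ⟨k, hk⟩ := exists_dist_ratPoint_lt hα x hs0
  obtain ⟨m, rfl⟩ : s ∈ Set.range r := by
    rw [hr]
    exact (by exact_mod_cast hs0.le : (0 : ℚ) ≤ s)
  exact ⟨Nat.pair k m, by simpa [basicBall, rationalPoint, ratPoint] using hk, by simpa using hsδ⟩

/-- Rounding each coordinate down to the grid costs at most one mesh width. The 2(N+1)²+1 possible
values per axis are the digits of `m` in that base. -/
theorem exists_ratGridPoint_dist_le (u : Fin n → ℚ) (N : ℕ) {z : EuclideanSpace ℝ (Fin n)}
    (hz : ∀ j, |z j - u j| ≤ N + 1) :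
    ∃ m < (2 * (N + 1) ^ 2 + 1) ^ n,
      dist z (ratPoint (ratGridPoint u N m)) ≤ n * (1 / ((N : ℝ) + 1)) := by
  have hN : (0 : ℝ) < (N : ℝ) + 1 := by positivity
  have hnn : ∀ j, 0 ≤ (z j - u j + (N + 1)) * (N + 1) := fun j =>
    mul_nonneg (by linarith [(abs_le.1 (hz j)).1]) hN.le
  have hlt : ∀ j, ⌊(z j - u j + (N + 1)) * (N + 1)⌋₊ < 2 * (N + 1) ^ 2 + 1 := fun j => by
    rw [Nat.lt_succ_iff]
    refine Nat.floor_le_of_le ?_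
    push_cast
    nlinarith [(abs_le.1 (hz j)).2]
  let d : Fin n → Fin (2 * (N + 1) ^ 2 + 1) := fun j => ⟨_, hlt j⟩
  refine ⟨finFunctionFinEquiv d, (finFunctionFinEquiv d).2,
    EuclideanSpace.dist_le_card_mul (by positivity) fun j => ?_⟩
  have hd : ((finFunctionFinEquiv d : ℕ) / (2 * (N + 1) ^ 2 + 1) ^ (j : ℕ) %
      (2 * (N + 1) ^ 2 + 1)) = ⌊(z j - u j + (N + 1)) * (N + 1)⌋₊ :=
    congrArg Fin.val (congrFun (finFunctionFinEquiv.symm_apply_apply d) j)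
  have h1 := Nat.floor_le (hnn j)
  have h2 := Nat.lt_floor_add_one ((z j - u j + (N + 1)) * (N + 1))
  change |z j - (ratGridPoint u N (finFunctionFinEquiv d) j : ℚ)| ≤ _
  rw [ratGridPoint, hd]
  generalize (⌊(z j - u j + (N + 1)) * (N + 1)⌋₊ : ℕ) = f at h1 h2
  push_cast
  have h3 : z j - (u j + (f * (1 / ((N : ℝ) + 1)) - (N + 1))) =
      ((z j - u j + (N + 1)) * (N + 1) - f) * (1 / ((N : ℝ) + 1)) := by
    field_simp
    ring
  rw [h3, abs_mul, abs_of_pos (by positivity : (0 : ℝ) < 1 / ((N : ℝ) + 1))]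
  refine mul_le_of_le_one_left (by positivity) ?_
  rw [abs_le]
  constructor <;> linarith

/-- The margin is paid twice: a grid point near z may lie outside the R-ball by n/(N+1), so the
tested region is enlarged; the listed ball is shrunk by as much, so it still contains z. -/
theorem CoverCertificate.exists_mem_basicBall {α : ℕ → Fin n → ℚ} {r : ℕ → ℚ} {u : Fin n → ℚ}
    {R : ℚ} {N : ℕ} {σ : List ℕ} (h : CoverCertificate α r u R N σ)
    {z : EuclideanSpace ℝ (Fin n)} (hz : dist z (ratPoint u) < R) :
    ∃ i, 4 * i + 1 < σ.length ∧
      z ∈ basicBall (rationalPoint α) r (σ.getD (4 * i + 1) 0) := by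
  obtain ⟨hR, hcov⟩ := h
  have hR' : (R : ℝ) < N + 1 := by exact_mod_cast hR
  have hN : (0 : ℝ) < (N : ℝ) + 1 := by positivity
  have hz' : ∀ j, |z j - u j| ≤ N + 1 := fun j =>
    (EuclideanSpace.abs_sub_le_dist z (ratPoint u) j).trans (hz.trans hR').le
  obtain ⟨m, hm, hzm⟩ := exists_ratGridPoint_dist_le u N hz'
  have hlt : dist (ratPoint (ratGridPoint u N m)) (ratPoint u) <
      ((R + (n : ℕ) * (1 / ((N : ℚ) + 1)) : ℚ) : ℝ) := by
    push_cast
    linarith [dist_triangle_left (ratPoint (ratGridPoint u N m)) (ratPoint u) z]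
  obtain ⟨i, -, hi, hdist⟩ := hcov m hm (ratDistLT_iff_dist.2 hlt)
  refine ⟨i, hi, ?_⟩
  rw [ratDistLT_iff_dist] at hdist
  push_cast at hdist
  have := dist_triangle z (ratPoint (ratGridPoint u N m))
    (ratPoint (α (σ.getD (4 * i + 1) 0).unpair.1))
  change dist z (ratPoint (α (σ.getD (4 * i + 1) 0).unpair.1)) <
    (r (σ.getD (4 * i + 1) 0).unpair.2 : ℝ)
  linarith

/-- Compactness of the closed ball of radius R' gives finitely many covering balls with a uniform
margin. The room between R and R' absorbs the enlarged region that the certificate tests. -/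
theorem exists_coverCertificate {α : ℕ → Fin n → ℚ} {r : ℕ → ℚ} {u : Fin n → ℚ} {R : ℚ} {R' : ℝ}
    (hR : (R : ℝ) < R') {q : ℕ → ℕ}
    (hcov : ∀ z, dist z (ratPoint u) ≤ R' → ∃ h, z ∈ basicBall (rationalPoint α) r (q h)) :
    ∃ N, ∀ σ : List ℕ, (∀ h < N, 4 * h + 1 < σ.length ∧ σ.getD (4 * h + 1) 0 = q h) →
      CoverCertificate α r u R N σ := by
  -- The first L balls, shrunk by n/(L+1). These sets increase with L and exhaust the union of the
  -- balls, so one of them contains the closed ball.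
  let U : ℕ → Set (EuclideanSpace ℝ (Fin n)) := fun L =>
    ⋃ h ∈ Set.Iio L, {z | dist z (rationalPoint α (q h).unpair.1) + n * (1 / ((L : ℝ) + 1)) <
      r (q h).unpair.2}
  have hU : Monotone U := by
    intro L M hLM z hz
    simp only [U, Set.mem_iUnion, Set.mem_Iio, Set.mem_ofPred_eq, exists_prop] at hz ⊢
    obtain ⟨h, hh, hz⟩ := hz
    refine ⟨h, hh.trans_le hLM, lt_of_le_of_lt ?_ hz⟩
    have : (L : ℝ) ≤ M := by exact_mod_cast hLM
    gcongr
  obtain ⟨L, hL⟩ := (isCompact_closedBall (ratPoint u) R').elim_directed_cover U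
    (fun L => isOpen_biUnion fun h _ => isOpen_lt (by fun_prop) (by fun_prop)) (by
      intro z hz
      obtain ⟨h, hh⟩ := hcov z hz
      have hpos : 0 < (r (q h).unpair.2 : ℝ) - dist z (rationalPoint α (q h).unpair.1) :=
        sub_pos.2 hh
      obtain ⟨M, hM⟩ := exists_nat_gt
        ((n : ℝ) / ((r (q h).unpair.2 : ℝ) - dist z (rationalPoint α (q h).unpair.1)))
      refine Set.mem_iUnion.2 ⟨max M (h + 1), ?_⟩
      simp only [U, Set.mem_iUnion, Set.mem_Iio, Set.mem_ofPred_eq, exists_prop]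
      refine ⟨h, by simp, ?_⟩
      have hM' : (M : ℝ) ≤ (max M (h + 1) : ℕ) := by exact_mod_cast le_max_left _ _
      rw [← lt_sub_iff_add_lt', mul_one_div, div_lt_iff₀ (by positivity)]
      rw [div_lt_iff₀ hpos] at hM
      nlinarith) hU.directed_le
  have hRR : 0 < R' - R := sub_pos.2 hR
  -- Beyond this bound the R-ball fits in the grid cube, and n/(N+1) ≤ R' - R.
  obtain ⟨M, hM⟩ := exists_nat_gt (max (R : ℝ) ((n : ℝ) / (R' - R)))
  refine ⟨max L M, fun σ hσ => ?_⟩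
  generalize hN : max L M = N at hσ
  have hLN : L ≤ N := hN ▸ le_max_left _ _
  have hMN : (M : ℝ) ≤ N := by exact_mod_cast hN ▸ le_max_right L M
  have hRN : (R : ℝ) < N + 1 := by linarith [(le_max_left _ _).trans_lt hM]
  have hnN : n * (1 / ((N : ℝ) + 1)) ≤ R' - R := by
    have := (le_max_right _ _).trans_lt hM
    rw [div_lt_iff₀ hRR] at this
    rw [mul_one_div, div_le_iff₀ (by positivity)]
    nlinarith
  refine ⟨by exact_mod_cast hRN, fun m _ hm => ?_⟩
  rw [ratDistLT_iff_dist] at hm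
  push_cast at hm
  have hmem := hU hLN (hL (Metric.mem_closedBall.2 (hm.le.trans (by linarith))))
  simp only [U, Set.mem_iUnion, Set.mem_Iio, Set.mem_ofPred_eq, exists_prop] at hmem
  obtain ⟨h, hh, hlt⟩ := hmem
  refine ⟨h, hh, (hσ h hh).1, ?_⟩
  rw [(hσ h hh).2, ratDistLT_iff_dist]
  push_cast
  change dist _ (rationalPoint α (q h).unpair.1) < _
  linarith

end Geometry

/-! ### Correctness of the search -/

section Correctness

variable {n : ℕ} {α : ℕ → Fin n → ℚ} {r : ℕ → ℚ} {E : ℕ}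

/-- The information about `x` and `A` contained in a name `p` of `(x, A)`. -/
structure IsProjectionInput (α : ℕ → Fin n → ℚ) (r : ℕ → ℚ) (p : ℕ → ℕ)
    (x : EuclideanSpace ℝ (Fin n)) (A : Set (EuclideanSpace ℝ (Fin n))) : Prop where
  dist_le : ∀ i, dist (rationalPoint α (p (2 * i))) x ≤ 1 / ((i : ℝ) + 1)
  notMem_iff : ∀ z, z ∉ A ↔ ∃ h, z ∈ basicBall (rationalPoint α) r (p (4 * h + 1))
  listed_iff : ∀ b, (∃ j, p (4 * j + 3) = b) ↔ (basicBall (rationalPoint α) r b ∩ A).Nonempty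

theorem IsProjectionInput.of_isName {p : ℕ → ℕ}
    {z : EuclideanSpace ℝ (Fin n) × Closeds (EuclideanSpace ℝ (Fin n))}
    (hp : ((cauchyRep (rationalPoint α)).prod (totalRep (rationalPoint α) r)).IsName p z) :
    IsProjectionInput α r p z.1 z.2 := by
  obtain ⟨⟨hC, hlim⟩, hneg, hpos⟩ := hp
  refine ⟨fun i => ?_, fun y => ?_, fun b => ?_⟩
  · have h1 : dist (rationalPoint α (p (2 * i))) z.1 ≤ (2 : ℝ)⁻¹ ^ i :=
      le_of_tendsto (tendsto_const_nhds.dist hlim) (eventually_atTop.2 ⟨i, hC i⟩)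
    refine h1.trans ?_
    rw [inv_pow, ← one_div]
    refine one_div_le_one_div_of_le (by positivity) ?_
    exact_mod_cast Nat.succ_le_of_lt i.lt_two_pow_self
  · rw [hneg]
    have h4 : ∀ h, evenPart (oddPart p) h = p (4 * h + 1) := fun h => by
      simp only [evenPart, oddPart]; congr 1; ring
    simp [h4]
  · rw [← hpos b]
    have h4 : ∀ h, oddPart (oddPart p) h = p (4 * h + 3) := fun h => by
      simp only [oddPart]; congr 1; ring
    simp [h4]

theorem List.getD_map_range (p : ℕ → ℕ) {L i : ℕ} (h : i < L) :
    ((List.range L).map p).getD i 0 = p i := by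
  simp [List.getD_eq_getElem?_getD, h]

variable {p : ℕ → ℕ} {x : EuclideanSpace ℝ (Fin n)} {A : Set (EuclideanSpace ℝ (Fin n))}

theorem ProjectionStep.sound (hp : IsProjectionInput α r p x A) (hA : A.Nonempty) {k t s L : ℕ}
    (h : ProjectionStep α r E (k, t, s, (List.range L).map p)) :
    (basicBall (rationalPoint α) r (Nat.unpairField 1 s) ∩ A).Nonempty ∧
    (r (Nat.unpairField 1 s).unpair.2 : ℝ) < 1 / 2 ^ (k + 2) ∧
    (Nat.unpairField 0 s = 0 → Nat.unpairField 0 t = 0 ∧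
      dist x (rationalPoint α (Nat.unpairField 1 s).unpair.1) +
        r (Nat.unpairField 1 s).unpair.2 < 1 / 2 ^ (k + 2)) ∧
    (Nat.unpairField 0 s ≠ 0 → Nat.unpairField 0 t = 0 →
      dist x (rationalPoint α (Nat.unpairField 1 s).unpair.1) + r (Nat.unpairField 1 s).unpair.2 ≤
        (1 + 1 / ((E : ℝ) + 1)) * Metric.infDist x A) ∧
    (Nat.unpairField 0 t ≠ 0 → Nat.unpairField 0 s ≠ 0 ∧
      dist (rationalPoint α (Nat.unpairField 1 t).unpair.1)
        (rationalPoint α (Nat.unpairField 1 s).unpair.1) + r (Nat.unpairField 1 s).unpair.2 <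
          r (Nat.unpairField 1 t).unpair.2) := by
  obtain ⟨hj, hb, hi, hρ, h⟩ := h
  -- The length tests rule out the default 0 of `getD`: the entries used are true digits of `p`.
  simp only [List.length_map, List.length_range] at hj hi
  rw [List.getD_map_range p hj] at hb
  have hdi := hp.dist_le (Nat.unpairField 3 s)
  have hρ' : (r (Nat.unpairField 1 s).unpair.2 : ℝ) < 1 / 2 ^ (k + 2) := by
    have := (Rat.cast_lt (K := ℝ)).2 hρ
    push_cast at this
    exact this
  refine ⟨(hp.listed_iff _).1 ⟨_, hb⟩, hρ', ?_⟩
  simp only [List.getD_map_range p hi] at h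
  have htri := dist_triangle_left x (rationalPoint α (Nat.unpairField 1 s).unpair.1)
    (rationalPoint α (p (2 * Nat.unpairField 3 s)))
  obtain ⟨ht, hs, hd⟩ | ⟨ht, hs, hd, hc⟩ | ⟨ht, hs, hd⟩ := h <;>
    rw [ratDistLT_iff_dist] at hd <;> push_cast at hd
  · refine ⟨fun _ => ⟨ht, ?_⟩, fun h => absurd hs h, fun h => absurd ht h⟩
    change dist (rationalPoint α _) (rationalPoint α _) < _ at hd
    linarith
  · refine ⟨fun h => absurd h hs, fun _ _ => ?_, fun h => absurd ht h⟩
    change dist (rationalPoint α _) (rationalPoint α _) < _ at hd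
    -- The certificate keeps A outside the R-ball around an approximation of x with error at most
    -- 1/(i+1).
    have hlow : (r (Nat.unpairField 4 s) : ℝ) - 1 / ((Nat.unpairField 3 s : ℝ) + 1) ≤
        Metric.infDist x A := by
      refine (Metric.le_infDist hA).2 fun {z} hz => ?_
      by_contra! hlt
      have hzu : dist z (rationalPoint α (p (2 * Nat.unpairField 3 s))) <
          r (Nat.unpairField 4 s) := by
        rw [dist_comm] at hdi hlt
        linarith [dist_triangle z x (rationalPoint α (p (2 * Nat.unpairField 3 s)))]
      obtain ⟨i, hi', hmem⟩ := hc.exists_mem_basicBall hzu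
      simp only [List.length_map, List.length_range] at hi'
      rw [List.getD_map_range p hi'] at hmem
      exact (hp.notMem_iff z).2 ⟨i, hmem⟩ hz
    have hE : 0 < 1 / ((E : ℝ) + 1) := by positivity
    nlinarith
  · refine ⟨fun h => absurd h hs, fun _ h => absurd h ht, fun _ => ⟨hs, ?_⟩⟩
    change dist (rationalPoint α _) (rationalPoint α _) < _ at hd
    linarith

/-! ### Termination of each search round -/

theorem exists_unpairField_eq (f b j i u N : ℕ) :
    ∃ s, Nat.unpairField 0 s = f ∧ Nat.unpairField 1 s = b ∧ Nat.unpairField 2 s = j ∧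
      Nat.unpairField 3 s = i ∧ Nat.unpairField 4 s = u ∧ Nat.unpairField 5 s = N ∧
      4 * j + 3 < Nat.unpairField 6 s ∧ 2 * i < Nat.unpairField 6 s ∧
      4 * N + 1 < Nat.unpairField 6 s :=
  ⟨Nat.pair f (Nat.pair b (Nat.pair j (Nat.pair i (Nat.pair u (Nat.pair N
    (Nat.pair (4 * j + 2 * i + 4 * N + 4) 0)))))),
    by simp only [Nat.unpairField_zero_pair, Nat.unpairField_succ_pair, true_and]; omega⟩

theorem exists_projectionStep_of_flag_ne_zero (hα : Function.Surjective α)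
    (hr : Set.range r = {s : ℚ | 0 ≤ s}) (hp : IsProjectionInput α r p x A)
    {t : ℕ} (ht0 : Nat.unpairField 0 t ≠ 0)
    (ht : (basicBall (rationalPoint α) r (Nat.unpairField 1 t) ∩ A).Nonempty) (k : ℕ) :
    ∃ s, ProjectionStep α r E (k, t, s, (List.range (Nat.unpairField 6 s)).map p) := by
  have hη : (0 : ℝ) < 1 / 2 ^ (k + 2) := by positivity
  obtain ⟨z, hzb, hzA⟩ := ht
  have hgap : 0 < (r (Nat.unpairField 1 t).unpair.2 : ℝ) -
      dist z (rationalPoint α (Nat.unpairField 1 t).unpair.1) := sub_pos.2 hzb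
  -- A ball containing z has diameter at most twice its radius, so half the gap keeps it inside the
  -- old ball.
  obtain ⟨b, hb, hbr⟩ := exists_mem_basicBall hα hr z (lt_min hη (half_pos hgap))
  rw [lt_min_iff] at hbr
  obtain ⟨j, hj⟩ := (hp.listed_iff b).2 ⟨z, hb, hzA⟩
  obtain ⟨s, h0, h1, h2, h3, h4, h5, h6, h7, h8⟩ := exists_unpairField_eq 1 b j 0 0 0
  refine ⟨s, ?_⟩
  simp only [ProjectionStep, h0, h1, h2, h3, h4, h5, List.length_map, List.length_range,
    List.getD_map_range p h6, List.getD_map_range p h7]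
  refine ⟨h6, hj, h7, ?_, Or.inr (Or.inr ⟨ht0, one_ne_zero, ratDistLT_iff_dist.2 ?_⟩)⟩
  · rw [← Rat.cast_lt (K := ℝ)]; push_cast; exact hbr.1
  · push_cast
    change dist (rationalPoint α _) (rationalPoint α _) < _
    have hb' : dist z (rationalPoint α b.unpair.1) < r b.unpair.2 := hb
    linarith [dist_triangle_left (rationalPoint α (Nat.unpairField 1 t).unpair.1)
      (rationalPoint α b.unpair.1) z]

theorem exists_projectionStep_of_mem (hα : Function.Surjective α)
    (hr : Set.range r = {s : ℚ | 0 ≤ s}) (hp : IsProjectionInput α r p x A) (hx : x ∈ A) {t : ℕ}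
    (ht0 : Nat.unpairField 0 t = 0) (k : ℕ) :
    ∃ s, ProjectionStep α r E (k, t, s, (List.range (Nat.unpairField 6 s)).map p) := by
  obtain ⟨b, hb, hbr⟩ := exists_mem_basicBall hα hr x (by positivity :
    (0 : ℝ) < 1 / 2 ^ (k + 2) / 4)
  obtain ⟨j, hj⟩ := (hp.listed_iff b).2 ⟨x, hb, hx⟩
  obtain ⟨i, hi⟩ := exists_nat_one_div_lt (by positivity : (0 : ℝ) < 1 / 2 ^ (k + 2) / 4)
  obtain ⟨s, h0, h1, h2, h3, h4, h5, h6, h7, h8⟩ := exists_unpairField_eq 0 b j i 0 0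
  refine ⟨s, ?_⟩
  simp only [ProjectionStep, h0, h1, h2, h3, h4, h5, List.length_map, List.length_range,
    List.getD_map_range p h6, List.getD_map_range p h7]
  refine ⟨h6, hj, h7, ?_, Or.inl ⟨ht0, trivial, ratDistLT_iff_dist.2 ?_⟩⟩
  · rw [← Rat.cast_lt (K := ℝ)]; push_cast
    exact hbr.trans (div_lt_self (by positivity) (by norm_num))
  · push_cast
    change dist (rationalPoint α _) (rationalPoint α _) < _
    have hb' : dist x (rationalPoint α b.unpair.1) < r b.unpair.2 := hb
    linarith [hp.dist_le i,
      dist_triangle (rationalPoint α (p (2 * i))) x (rationalPoint α b.unpair.1)]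

/-- With slack g = R(1+e) - D₃, the errors amount to at most 4η + 2ρ, and η < g/8, ρ < g/4 keep this
below g. -/
theorem lt_of_approximations {D D₁ D₂ D₃ D₄ R ρ η e : ℝ} (h₁ : D₁ ≤ η) (h : D ≤ D₁ + D₂)
    (h₂ : D₂ ≤ D₃ + D₄) (h₄ : D₄ < ρ) (hρ : ρ < (R * (1 + e) - D₃) / 4)
    (hη : η < (R * (1 + e) - D₃) / 8) (hη0 : 0 ≤ η) (he : e ≤ 1) :
    D < R - η + (R - η) * e - η - ρ := by
  have h₅ : η * e ≤ η := mul_le_of_le_one_right hη0 he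
  linarith

theorem exists_projectionStep_of_infDist_pos (hα : Function.Surjective α)
    (hr : Set.range r = {s : ℚ | 0 ≤ s}) (hp : IsProjectionInput α r p x A) (hA : A.Nonempty)
    (hd : 0 < Metric.infDist x A) {t : ℕ} (ht0 : Nat.unpairField 0 t = 0) (k : ℕ) :
    ∃ s, ProjectionStep α r E (k, t, s, (List.range (Nat.unpairField 6 s)).map p) := by
  have hη : (0 : ℝ) < 1 / 2 ^ (k + 2) := by positivity
  have hE : 0 < 1 / ((E : ℝ) + 1) := by positivity
  have hE1 : 1 / ((E : ℝ) + 1) ≤ 1 := by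
    rw [div_le_one (by positivity)]
    exact le_add_of_nonneg_left (Nat.cast_nonneg E)
  -- R < d(x,A) leaves room for a cover, and R(1+e) > d(x,A) leaves room for a point of A.
  obtain ⟨R, hR1, hR2⟩ := exists_rat_btwn (show Metric.infDist x A / (1 + 1 / ((E : ℝ) + 1)) <
      Metric.infDist x A from
    div_lt_self hd (by linarith))
  rw [div_lt_iff₀ (by positivity)] at hR1
  have hR0 : (0 : ℝ) < R := by
    by_contra! h
    nlinarith
  obtain ⟨u, rfl⟩ : R ∈ Set.range r := by
    rw [hr]
    exact (by exact_mod_cast hR0.le : (0 : ℚ) ≤ R)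
  obtain ⟨z, hzA, hz⟩ := (Metric.infDist_lt_iff hA).1 hR1
  have hgap : 0 < (r u : ℝ) * (1 + 1 / ((E : ℝ) + 1)) - dist x z := sub_pos.2 hz
  obtain ⟨b, hb, hbr⟩ := exists_mem_basicBall hα hr z (lt_min hη
    (by positivity : 0 < ((r u : ℝ) * (1 + 1 / ((E : ℝ) + 1)) - dist x z) / 4))
  rw [lt_min_iff] at hbr
  obtain ⟨j, hj⟩ := (hp.listed_iff b).2 ⟨z, hb, hzA⟩
  obtain ⟨i, hi⟩ := exists_nat_one_div_lt (lt_min (sub_pos.2 hR2)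
    (by positivity : 0 < ((r u : ℝ) * (1 + 1 / ((E : ℝ) + 1)) - dist x z) / 8))
  rw [lt_min_iff] at hi
  -- R' is the midpoint of R and d(x,A) - 1/(i+1), so the closed R'-ball around the approximation
  -- still misses A.
  obtain ⟨N, hN⟩ := exists_coverCertificate (α := α) (r := r) (u := α (p (2 * i))) (R := r u)
    (R' := (r u + (Metric.infDist x A - 1 / ((i : ℝ) + 1))) / 2) (q := fun h => p (4 * h + 1))
    (by linarith) (fun z hz => (hp.notMem_iff z).1 fun hzA' => by
      have h1 := Metric.infDist_le_dist_of_mem (x := x) hzA'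
      change dist z (rationalPoint α (p (2 * i))) ≤ _ at hz
      have h2 := dist_triangle z (rationalPoint α (p (2 * i))) x
      rw [dist_comm z x] at h2
      linarith [hp.dist_le i])
  obtain ⟨s, h0, h1, h2, h3, h4, h5, h6, h7, h8⟩ := exists_unpairField_eq 1 b j i u N
  refine ⟨s, ?_⟩
  simp only [ProjectionStep, h0, h1, h2, h3, h4, h5, List.length_map, List.length_range,
    List.getD_map_range p h6, List.getD_map_range p h7]
  refine ⟨h6, hj, h7, ?_, Or.inr (Or.inl ⟨ht0, one_ne_zero, ratDistLT_iff_dist.2 ?_,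
    hN _ fun h hh => ?_⟩)⟩
  · rw [← Rat.cast_lt (K := ℝ)]; push_cast; exact hbr.1
  · push_cast
    change dist (rationalPoint α _) (rationalPoint α _) < _
    have hb' : dist z (rationalPoint α b.unpair.1) < r b.unpair.2 := hb
    have h9 := dist_triangle (rationalPoint α (p (2 * i))) x (rationalPoint α b.unpair.1)
    have h10 := dist_triangle x z (rationalPoint α b.unpair.1)
    exact lt_of_approximations (hp.dist_le i) h9 h10 hb' hbr.2 hi.2 Nat.one_div_pos_of_nat.le hE1
  · have : 4 * h + 1 < Nat.unpairField 6 s := by omega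
    exact ⟨by simpa using this, List.getD_map_range p this⟩

/-- The case split on d(x,A) = 0 occurs only in this termination argument; the program never decides
it. -/
theorem exists_projectionStep (hα : Function.Surjective α)
    (hr : Set.range r = {s : ℚ | 0 ≤ s}) (hp : IsProjectionInput α r p x A) (hAc : IsClosed A) (hA : A.Nonempty) {t : ℕ}
    (ht : Nat.unpairField 0 t ≠ 0 →
      (basicBall (rationalPoint α) r (Nat.unpairField 1 t) ∩ A).Nonempty) (k : ℕ) :
    ∃ s, ProjectionStep α r E (k, t, s, (List.range (Nat.unpairField 6 s)).map p) := by
  by_cases ht0 : Nat.unpairField 0 t = 0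
  · obtain hd | hd := (Metric.infDist_nonneg (x := x) (s := A)).eq_or_lt
    · exact exists_projectionStep_of_mem hα hr hp ((hAc.mem_iff_infDist_zero hA).2 hd.symm) ht0 k
    · exact exists_projectionStep_of_infDist_pos hα hr hp hA hd ht0 k
  · exact exists_projectionStep_of_flag_ne_zero hα hr hp ht0 (ht ht0) k

/-- A sequence of balls that meet a closed set, with radii tending to zero, and whose centres either
approach `x` or are trapped in the first ball of a nested sequence. -/
theorem exists_limit_of_steps {X : Type*} [MetricSpace X] [CompleteSpace X] {A : Set X} {x : X}
    (hAc : IsClosed A) (hA : A.Nonempty) {ε : ℝ} (hε0 : 0 ≤ ε) (hε1 : ε ≤ 1)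
    {f : ℕ → Prop} {a : ℕ → X} {ρ : ℕ → ℝ}
    (hmeet : ∀ k, (Metric.ball (a k) (ρ k) ∩ A).Nonempty) (hρ : ∀ k, ρ k < 1 / 2 ^ (k + 2))
    (hnear : ∀ k, f k → dist x (a k) + ρ k < 1 / 2 ^ (k + 2))
    (hf : ∀ k, f (k + 1) → f k)
    (hfar : ∀ k, ¬ f k → (∀ m < k, f m) → dist x (a k) + ρ k ≤ (1 + ε) * Metric.infDist x A)
    (hstep : ∀ k, ¬ f k → dist (a k) (a (k + 1)) + ρ (k + 1) < ρ k) :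
    (∀ i j, i ≤ j → dist (a i) (a j) ≤ (2 : ℝ)⁻¹ ^ i) ∧
      ∃ y ∈ A, dist x y ≤ (1 + ε) * Metric.infDist x A ∧ Tendsto a atTop (𝓝 y) := by
  have nested : ∀ i j, i ≤ j → ¬ f i → ¬ f j ∧ dist (a i) (a j) + ρ j ≤ ρ i := by
    intro i j hij hi
    induction j, hij using Nat.le_induction with
    | base => exact ⟨hi, by simp⟩
    | succ j _ ih =>
      exact ⟨fun h => ih.1 (hf j h),
        by linarith [ih.2, hstep j ih.1, dist_triangle (a i) (a j) (a (j + 1))]⟩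
  -- The bound holds at the first round with the flag set and passes to the nested later balls.
  have far : ∀ k, ¬ f k → dist x (a k) + ρ k ≤ (1 + ε) * Metric.infDist x A := by
    classical
    intro k hk
    have hex : ∃ k, ¬ f k := ⟨k, hk⟩
    have h1 := hfar _ (Nat.find_spec hex) fun m hm => not_not.1 (Nat.find_min hex hm)
    have h2 := (nested _ k (Nat.find_min' hex hk) (Nat.find_spec hex)).2
    linarith [dist_triangle x (a (Nat.find hex)) (a k)]
  have hρ0 : ∀ k, 0 < ρ k := fun k => by
    obtain ⟨w, hw, -⟩ := hmeet k
    exact dist_nonneg.trans_lt hw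
  have hd : ∀ k, f k → Metric.infDist x A < 1 / 2 ^ (k + 2) := fun k hk => by
    obtain ⟨w, hw, hwA⟩ := hmeet k
    rw [Metric.mem_ball'] at hw
    linarith [hnear k hk, Metric.infDist_le_dist_of_mem (x := x) hwA, dist_triangle x (a k) w]
  have hpow : ∀ k : ℕ, (2 : ℝ)⁻¹ ^ k = 4 * (1 / 2 ^ (k + 2)) := fun k => by
    rw [inv_pow, pow_add]
    field_simp
    norm_num
  have hcauchy : ∀ i j, i ≤ j → dist (a i) (a j) ≤ (2 : ℝ)⁻¹ ^ i := by
    intro i j hij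
    have hη : (1 : ℝ) / 2 ^ (j + 2) ≤ 1 / 2 ^ (i + 2) :=
      one_div_le_one_div_of_le (by positivity) (pow_le_pow_right₀ one_le_two (by omega))
    have hη0 : (0 : ℝ) < 1 / 2 ^ (i + 2) := by positivity
    rw [hpow]
    -- With η = 2^-(i+2): two near rounds differ by less than 2η, a near and a far one by less than
    -- η + (1+ε)η ≤ 3η, two far ones by less than η. All are below 4η = 2^-i.
    by_cases hi : f i
    · have h1 := hnear i hi
      have h2 := dist_triangle_left (a i) (a j) x
      by_cases hj : f j
      · linarith [hnear j hj, hρ0 i, hρ0 j]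
      · nlinarith [far j hj, hd i hi, hρ0 i, hρ0 j, Metric.infDist_nonneg (x := x) (s := A)]
    · linarith [(nested i j hij hi).2, hρ i, hρ0 j]
  refine ⟨hcauchy, ?_⟩
  have hhalf : Tendsto (fun k : ℕ => (2 : ℝ)⁻¹ ^ k) atTop (𝓝 0) :=
    tendsto_pow_atTop_nhds_zero_of_lt_one (by norm_num) (by norm_num)
  obtain ⟨y, hy⟩ := cauchySeq_tendsto_of_complete (cauchySeq_of_le_tendsto_0' _ hcauchy hhalf)
  have hle : ∀ k : ℕ, (1 : ℝ) / 2 ^ (k + 2) ≤ (2 : ℝ)⁻¹ ^ k := fun k => by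
    have : (0 : ℝ) < 1 / 2 ^ (k + 2) := by positivity
    rw [hpow]; linarith
  refine ⟨y, (hAc.mem_iff_infDist_zero hA).2 (le_antisymm ?_ Metric.infDist_nonneg), ?_, hy⟩
  · refine le_of_tendsto_of_tendsto' (((Metric.continuous_infDist_pt A).tendsto y).comp hy) hhalf
      fun k => ?_
    obtain ⟨w, hw, hwA⟩ := hmeet k
    rw [Metric.mem_ball'] at hw
    exact (Metric.infDist_le_dist_of_mem hwA).trans (hw.le.trans ((hρ k).le.trans (hle k)))
  · refine le_of_tendsto_of_tendsto' (tendsto_const_nhds.dist hy)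
      (zero_add ((1 + ε) * Metric.infDist x A) ▸ hhalf.add_const _) fun k => ?_
    have h0 : 0 ≤ (1 + ε) * Metric.infDist x A :=
      mul_nonneg (by linarith) Metric.infDist_nonneg
    have h1 := hle k
    have h2 : (0 : ℝ) < 1 / 2 ^ (k + 2) := by positivity
    by_cases hk : f k
    · linarith [hnear k hk, hρ0 k]
    · linarith [far k hk, hρ0 k]

end Correctness

/-- Every program computes a partial function on Baire space. -/
theorem exists_baireComputable_of_oracleCode (c : OracleCode) :
    ∃ F : (ℕ → ℕ) →. (ℕ → ℕ), BaireComputable F ∧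
      ∀ p q, (∀ k, q k ∈ c.eval p k) → q ∈ F p := by
  have key : ∀ p q, q ∈ (⟨∀ k, (c.eval p k).Dom, fun h k => (c.eval p k).get (h k)⟩ :
      Part (ℕ → ℕ)) ↔ ∀ k, q k ∈ c.eval p k := by
    intro p q
    constructor
    · rintro ⟨h, rfl⟩ k
      exact Part.get_mem (h k)
    · intro h
      exact ⟨fun k => (h k).1, funext fun k => (h k).2⟩
  exact ⟨_, ⟨c, key⟩, fun p q => (key p q).2⟩

theorem mainTheorem9 (n : ℕ) (hn : 1 ≤ n) (ε : ℝ) (hε : 0 < ε)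
    (α : ℕ → Fin n → ℚ) (hα : IsEffectiveEnumeration α)
    (r : ℕ → ℚ) (hr : IsEffectiveRadiusEnumeration r) :
    ComputableMultimap
      ((cauchyRep (rationalPoint α)).prod (totalRep (rationalPoint α) r))
      (cauchyRep (rationalPoint α))
      (approxProjection (EuclideanSpace ℝ (Fin n)) ε) := by
  -- The real ε need not be computable; the smaller rational 1/(E+1) replaces it, and being at most
  -- 1 it also serves the Cauchy rate.
  obtain ⟨E, hE⟩ := exists_nat_one_div_lt hε
  obtain ⟨c, hc⟩ := exists_oracleCode_iterated_search
    (ComputablePred.projectionStep hα.1 hr.1 E) (Computable.nat_unpairField 6)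
    (Computable.fst.comp (Computable.unpair.comp (Computable.nat_unpairField 1)))
  obtain ⟨F, hF, hcF⟩ := exists_baireComputable_of_oracleCode c
  refine ⟨F, hF, fun p z hpz hA => ?_⟩
  have hp := IsProjectionInput.of_isName hpz
  obtain ⟨t, ht0, hstep, ht⟩ := hc p
    (fun t => Nat.unpairField 0 t ≠ 0 →
      (basicBall (rationalPoint α) r (Nat.unpairField 1 t) ∩ z.2).Nonempty)
    -- The initial state 0 unpairs to zeros, so its flag is unset and the invariant is vacuous.
    (fun h => absurd (by simp [Nat.unpairField]) h)
    (fun k _ hs => exists_projectionStep hα.2 hr.2 hp z.2.isClosed hA hs k)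
    (fun _ _ _ hs _ => (hs.sound hp hA).1)
  have hsound := fun k => (hstep k).sound hp hA
  have hE1 : 1 / ((E : ℝ) + 1) ≤ 1 := by
    rw [div_le_one (by positivity)]
    exact le_add_of_nonneg_left (Nat.cast_nonneg E)
  obtain ⟨hcauchy, y, hyA, hxy, hlim⟩ := exists_limit_of_steps z.2.isClosed hA
    Nat.one_div_pos_of_nat.le hE1 (x := z.1) (f := fun k => Nat.unpairField 0 (t (k + 1)) = 0)
    (a := fun k => rationalPoint α (Nat.unpairField 1 (t (k + 1))).unpair.1)
    (ρ := fun k => r (Nat.unpairField 1 (t (k + 1))).unpair.2)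
    (fun k => (hsound k).1) (fun k => (hsound k).2.1)
    (fun k hk => ((hsound k).2.2.1 hk).2) (fun k hk => ((hsound (k + 1)).2.2.1 hk).1)
    (fun k hk hlt => (hsound k).2.2.2.1 hk (by
      cases k with
      | zero => simp [ht0, Nat.unpairField]
      | succ k => exact hlt k k.lt_succ_self))
    (fun k hk => ((hsound (k + 1)).2.2.2.2 hk).2)
  refine ⟨_, hcF p _ ht, y, ⟨hyA, hxy.trans ?_⟩, hcauchy, hlim⟩
  have := Metric.infDist_nonneg (x := z.1) (s := z.2)
  gcongr
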